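/- Let $I,J\subseteq\mathbb R$ be nonempty open intervals and let $\alpha:I\to\mathbb R^3$, $\beta:J\to\mathbb R^3$ be smooth ($C^\infty$) curves such that $X(s,t)=\alpha(s)+\beta(t)$, $(s,t)\in I\times J$, is a regular parametrized surface, i.e. $X_s=\alpha'(s)$ and $X_t=\beta'(t)$ are linearly independent for all $(s,t)\in I\times J$ (a translation surface with generating curves $\alpha,\beta$). Let $K=\frac{ln-m^2}{EG-F^2}$ be its Gauss curvature, where $E,F,G$ and $l,m,n$ are the coefficients of the first and second fundamental forms of $X$. (1) If $K(s,t)=0$ for all $(s,t)\in I\times J$, then $X$ is a cylindrical surface, i.e. a ruled surface whose rulings are all parallel to a fixed direction: there are a vector $v\neq 0$, an open set $D\subseteq\mathbb R^2$, a $C^\infty$ diffeomorphism $\varphi:D\to I\times J$ and a smooth curve $\gamma$, defined on the projection of $D$ to the first coordinate, such that $X(\varphi(u,r))=\gamma(u)+r\,v$ for all $(u,r)\in D$. (2) If one of the curves $\alpha$, $\beta$ is planar (contained in an affine plane of $\mathbb R^3$), then there is no constant $K_0\neq 0$ such that $K(s,t)=K_0$ for all $(s,t)\in I\times J$. -/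

import Mathlib

open scoped ContDiff

noncomputable section

/-- Euclidean three-space. -/
abbrev E3 : Type := EuclideanSpace ℝ (Fin 3)

/-- The vector product of Euclidean three-space. -/
def cross (x y : E3) : E3 := WithLp.toLp 2 (crossProduct (WithLp.ofLp x) (WithLp.ofLp y))

/-- First partial derivatives of a parametrized surface. -/
def partialS (X : ℝ → ℝ → E3) (s t : ℝ) : E3 := deriv (fun s' => X s' t) s

def partialT (X : ℝ → ℝ → E3) (s t : ℝ) : E3 := deriv (fun t' => X s t') t

/-- The unit normal (Gauss map) of a parametrized surface. -/
def unitNormal (X : ℝ → ℝ → E3) (s t : ℝ) : E3 :=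
  ‖cross (partialS X s t) (partialT X s t)‖⁻¹ • cross (partialS X s t) (partialT X s t)

/-- The coefficients `E`, `F`, `G` of the first fundamental form. -/
def firstE (X : ℝ → ℝ → E3) (s t : ℝ) : ℝ := inner ℝ (partialS X s t) (partialS X s t)

def firstF (X : ℝ → ℝ → E3) (s t : ℝ) : ℝ := inner ℝ (partialS X s t) (partialT X s t)

def firstG (X : ℝ → ℝ → E3) (s t : ℝ) : ℝ := inner ℝ (partialT X s t) (partialT X s t)

/-- The coefficients `l`, `m`, `n` of the second fundamental form. -/
def secondL (X : ℝ → ℝ → E3) (s t : ℝ) : ℝ :=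
  inner ℝ (unitNormal X s t) (partialS (partialS X) s t)

def secondM (X : ℝ → ℝ → E3) (s t : ℝ) : ℝ :=
  inner ℝ (unitNormal X s t) (partialS (partialT X) s t)

def secondN (X : ℝ → ℝ → E3) (s t : ℝ) : ℝ :=
  inner ℝ (unitNormal X s t) (partialT (partialT X) s t)

/-- The Gauss curvature `(l n - m²) / (E G - F²)` of a parametrized surface. -/
def gaussCurvature (X : ℝ → ℝ → E3) (s t : ℝ) : ℝ :=
  (secondL X s t * secondN X s t - secondM X s t ^ 2) /
    (firstE X s t * firstG X s t - firstF X s t ^ 2)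

/-- The sum `X(s,t) = α(s) + β(t)` of two curves. -/
def translationMap (α β : ℝ → E3) (s t : ℝ) : E3 := α s + β t

/-- `X(s,t) = α(s) + β(t)`, with `(s,t) ∈ I × J`, is a (smooth, regular) translation surface:
`I` and `J` are nonempty open intervals, the curves are smooth, and the partial derivatives
of `X` are linearly independent at every point. -/
structure IsTranslationSurface (α β : ℝ → E3) (I J : Set ℝ) : Prop where
  isOpen_left : IsOpen I
  isOpen_right : IsOpen J
  ordConnected_left : I.OrdConnected
  ordConnected_right : J.OrdConnected
  nonempty_left : I.Nonempty
  nonempty_right : J.Nonempty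
  smooth_left : ContDiffOn ℝ ∞ α I
  smooth_right : ContDiffOn ℝ ∞ β J
  regular : ∀ s ∈ I, ∀ t ∈ J, LinearIndependent ℝ
    ![partialS (translationMap α β) s t, partialT (translationMap α β) s t]

/-- A parametrized surface `X` on `U ⊆ ℝ²` is cylindrical if, after a smooth change of
parameters `e` (a diffeomorphism of an open set `e.source ⊆ ℝ²` onto `U`), it becomes
`(u, r) ↦ γ(u) + r v`, a ruled surface with a smooth base curve `γ` whose rulings are all
parallel to the fixed direction `v ≠ 0`. -/
def IsCylindrical (X : ℝ → ℝ → E3) (U : Set (ℝ × ℝ)) : Prop :=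
  ∃ (v : E3) (γ : ℝ → E3) (e : OpenPartialHomeomorph (ℝ × ℝ) (ℝ × ℝ)),
    v ≠ 0 ∧ e.target = U ∧
    ContDiffOn ℝ ∞ e e.source ∧ ContDiffOn ℝ ∞ e.symm e.target ∧
    ContDiffOn ℝ ∞ γ (Prod.fst '' e.source) ∧
    ∀ q ∈ e.source, X (e q).1 (e q).2 = γ q.1 + q.2 • v

end

/-!
Since `X_st = 0`, the coefficient `m` vanishes and, with `W² = EG - F² = |α' × β'|²`,
`K W⁴ = det(α', β', α'') det(α', β', β'')`.

**Flat surfaces.** If `K = 0`, then at each `(s, t)` one of the two determinants vanishes. Suppose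
that neither curve is a line, so that `α''` and `α'` are independent at some `s₀`, and `β''` and
`β'` at some `t₀`. Where `β''` and `β'` are independent, `det(α', β', α'')` is zero for all `s`:
otherwise `α'` would move for a while inside the fixed plane of `β'` and `β''`, so this plane would
be that of `α'` and `α''` (`IsTranslationSurface.inner_cross_left_eq_zero`). Symmetrically, where
`α'' ∦ α'`, the vector `α'` is orthogonal to `M = (β' × β'')(t₀)`; where `α'' ∥ α'` the direction of
`α'` is stationary, so it never leaves the plane `Mᗮ` (`inner_eq_zero_of_cross_eq_zero_or`), and the
same holds for `β'`. So a generating curve is a line or the whole surface lies in a plane. In each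
case `X = γ(u) + r v` with `(u, r) = f(s) + g(t)` for smooth plane curves `f`, `g` with independent
velocities. Such a map is automatically injective (`injOn_sum_of_det_ne_zero`), so it is a
diffeomorphism onto its image and its inverse is the required change of parameters.

**Constant curvature.** Let `α` be planar and `K ≠ 0`. In an orthonormal basis adapted to the plane
write `α' = x (1, m, 0)` and `β' = c (a, b, 1)`. The curvature equation becomes
`b' - m a' = c φ (1 + m² + (b - m a)²)²` with `φ = K x / m'` depending on `s` only. The left side is
affine in `m`. Taking the derivatives of order zero, one and two with respect to `m` at a point
where `m = 0` (`exists_derivatives_of_pencil`) yields, for `q = b` and `z = -a / (1 + b²)`, the flow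
`q' = k (1 + q²)²`, `z' = k (1 + q²) (2 q z + μ)` and the relation
`(1 + q²) ((3 q² + 1) z² + 2 μ q z + ν) + 1 = 0`, with constants `μ`, `ν` and `k = k(t) ≠ 0`.
Differentiating the relation twice along the flow gives two quadratic equations for `z` over the
polynomials in `q`. As `q` takes infinitely many values, their resultant is the zero polynomial,
which forces `μ = 0` and `μ² + ν = 0`; then `q z² = 0`, and the relation itself fails
(`false_of_quadratic_along_flow`).
-/

/-! ### The vector product -/

theorem inner_eq_sum (x y : E3) : inner ℝ x y = x 0 * y 0 + x 1 * y 1 + x 2 * y 2 := by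
  simp [PiLp.inner_apply, Fin.sum_univ_three]; ring

@[simp] theorem cross_apply_zero (x y : E3) : cross x y 0 = x 1 * y 2 - x 2 * y 1 := by
  simp [cross, crossProduct]

@[simp] theorem cross_apply_one (x y : E3) : cross x y 1 = x 2 * y 0 - x 0 * y 2 := by
  simp [cross, crossProduct]

@[simp] theorem cross_apply_two (x y : E3) : cross x y 2 = x 0 * y 1 - x 1 * y 0 := by
  simp [cross, crossProduct]

theorem E3.ext_coord {x y : E3} (h0 : x 0 = y 0) (h1 : x 1 = y 1) (h2 : x 2 = y 2) : x = y := by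
  ext i; fin_cases i <;> assumption

theorem cross_eq_neg_cross_swap (x y : E3) : cross x y = -cross y x := by
  apply E3.ext_coord <;> simp <;> ring

theorem inner_cross_self_left (x y : E3) : inner ℝ (cross x y) x = 0 := by
  simp [inner_eq_sum]; ring

/-- Lagrange's identity. -/
theorem inner_cross_cross (x y z w : E3) :
    inner ℝ (cross x y) (cross z w) =
      inner ℝ x z * inner ℝ y w - inner ℝ x w * inner ℝ y z := by
  simp [inner_eq_sum]; ring

/-- The scalar product with `x × y`, times its length, is the scalar product with a vector `n`, up
to the scalar products of `n` with `x` and `y`. -/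
theorem inner_cross_self_mul (x y n w : E3) :
    inner ℝ (cross x y) (cross x y) * inner ℝ n w =
      inner ℝ (cross x y) n * inner ℝ (cross x y) w +
        inner ℝ n x * inner ℝ (cross y (cross x y)) w +
        inner ℝ n y * inner ℝ (cross (cross x y) x) w := by
  simp only [inner_eq_sum, cross_apply_zero, cross_apply_one, cross_apply_two]
  ring

/-- The product of two triple products is a Gram determinant. -/
theorem inner_cross_mul_inner_cross (x y z w : E3) :
    inner ℝ (cross x y) z * inner ℝ (cross x y) w =
      inner ℝ x x * (inner ℝ y y * inner ℝ z w - inner ℝ y w * inner ℝ z y) -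
        inner ℝ x y * (inner ℝ y x * inner ℝ z w - inner ℝ y w * inner ℝ z x) +
        inner ℝ x w * (inner ℝ y x * inner ℝ z y - inner ℝ y y * inner ℝ z x) := by
  simp only [inner_eq_sum, cross_apply_zero, cross_apply_one, cross_apply_two]
  ring

/-- Three vectors orthogonal to a nonzero vector have vanishing triple product. -/
theorem inner_cross_eq_zero_of_orthogonal {n x y z : E3} (hn : n ≠ 0) (hx : inner ℝ n x = 0)
    (hy : inner ℝ n y = 0) (hz : inner ℝ n z = 0) : inner ℝ (cross x y) z = 0 := by
  have key : (inner ℝ (cross x y) z) • n =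
      (inner ℝ n x) • cross y z + (inner ℝ n y) • cross z x + (inner ℝ n z) • cross x y := by
    apply E3.ext_coord <;> simp [inner_eq_sum] <;> ring
  rw [hx, hy, hz] at key
  simpa [hn] using key

theorem linearIndependent_iff_cross_ne_zero (x y : E3) :
    LinearIndependent ℝ ![x, y] ↔ cross x y ≠ 0 := by
  have h := @crossProduct_ne_zero_iff_linearIndependent ℝ _ (WithLp.ofLp x) (WithLp.ofLp y)
  have h1 : cross x y ≠ 0 ↔ crossProduct (WithLp.ofLp x) (WithLp.ofLp y) ≠ 0 := by
    rw [cross, Ne, WithLp.toLp_eq_zero]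
  rw [h1, h, LinearIndependent.pair_iff, LinearIndependent.pair_iff]
  have h2 : ∀ s t : ℝ, s • WithLp.ofLp x + t • WithLp.ofLp y = 0 ↔ s • x + t • y = 0 :=
    fun s t => ⟨fun h => congrArg (WithLp.toLp 2) h, fun h => congrArg WithLp.ofLp h⟩
  simp only [h2]

/-! ### The curvature of a translation surface -/

theorem partialS_translationMap (α β : ℝ → E3) (s t : ℝ) :
    partialS (translationMap α β) s t = deriv α s := by
  simp [partialS, translationMap]

theorem partialT_translationMap (α β : ℝ → E3) (s t : ℝ) :
    partialT (translationMap α β) s t = deriv β t := by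
  simp [partialT, translationMap]

/-- The square of the area element times the Gauss curvature of a translation surface: the mixed
coefficient `m` vanishes because `X_st = 0`. -/
theorem gaussCurvature_translationMap_mul (α β : ℝ → E3) (s t : ℝ)
    (h : cross (deriv α s) (deriv β t) ≠ 0) :
    gaussCurvature (translationMap α β) s t *
        inner ℝ (cross (deriv α s) (deriv β t)) (cross (deriv α s) (deriv β t)) ^ 2 =
      inner ℝ (cross (deriv α s) (deriv β t)) (deriv (deriv α) s) *
        inner ℝ (cross (deriv α s) (deriv β t)) (deriv (deriv β) t) := by
  have hn : ‖cross (deriv α s) (deriv β t)‖ ≠ 0 := norm_ne_zero_iff.mpr h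
  have hm : partialS (partialT (translationMap α β)) s t = 0 := by
    simp [partialS, partialT, translationMap]
  have hl : partialS (partialS (translationMap α β)) s t = deriv (deriv α) s := by
    simp [partialS, translationMap]
  have hnn : partialT (partialT (translationMap α β)) s t = deriv (deriv β) t := by
    simp [partialT, translationMap]
  have hW : firstE (translationMap α β) s t * firstG (translationMap α β) s t -
      firstF (translationMap α β) s t ^ 2 = ‖cross (deriv α s) (deriv β t)‖ ^ 2 := by
    rw [← real_inner_self_eq_norm_sq, inner_cross_cross, firstE, firstF, firstG,
      partialS_translationMap, partialT_translationMap, real_inner_comm (deriv α s) (deriv β t)]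
    ring
  rw [gaussCurvature, hW, real_inner_self_eq_norm_sq]
  simp only [secondL, secondM, secondN, hm, hl, hnn, unitNormal, partialS_translationMap,
    partialT_translationMap, inner_zero_right, real_inner_smul_left]
  field_simp
  ring

namespace IsTranslationSurface

variable {α β : ℝ → E3} {I J : Set ℝ}

theorem cross_ne_zero (h : IsTranslationSurface α β I J) {s t : ℝ} (hs : s ∈ I) (ht : t ∈ J) :
    cross (deriv α s) (deriv β t) ≠ 0 := by
  have := h.regular s hs t ht
  rwa [linearIndependent_iff_cross_ne_zero, partialS_translationMap,
    partialT_translationMap] at this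

end IsTranslationSurface

/-! ### Calculus on open intervals -/

theorem ContDiffOn.hasDerivAt_of_isOpen {E : Type*} [NormedAddCommGroup E] [NormedSpace ℝ E]
    {f : ℝ → E} {I : Set ℝ} (hf : ContDiffOn ℝ ∞ f I) (hI : IsOpen I) {s : ℝ} (hs : s ∈ I) :
    HasDerivAt f (deriv f s) s :=
  ((hf.differentiableOn (by simp)).differentiableAt (hI.mem_nhds hs)).hasDerivAt

theorem ContDiffOn.deriv_infty {E : Type*} [NormedAddCommGroup E] [NormedSpace ℝ E]
    {f : ℝ → E} {I : Set ℝ} (hf : ContDiffOn ℝ ∞ f I) (hI : IsOpen I) :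
    ContDiffOn ℝ ∞ (deriv f) I :=
  hf.deriv_of_isOpen hI (by simp)

/-- Rolle's theorem on an interval, without an order on the two points. -/
theorem exists_deriv_eq_zero_of_ordConnected {I : Set ℝ} (hI : I.OrdConnected) {f f' : ℝ → ℝ}
    (hf : ∀ s ∈ I, HasDerivAt f (f' s) s) {s₁ s₂ : ℝ} (h₁ : s₁ ∈ I) (h₂ : s₂ ∈ I) (hne : s₁ ≠ s₂)
    (heq : f s₁ = f s₂) : ∃ s ∈ I, f' s = 0 := by
  wlog hlt : s₁ < s₂ generalizing s₁ s₂
  · exact this h₂ h₁ hne.symm heq.symm (lt_of_le_of_ne (not_lt.mp hlt) hne.symm)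
  have hsub : Set.Icc s₁ s₂ ⊆ I := hI.out h₁ h₂
  obtain ⟨c, hc, hc'⟩ := exists_hasDerivAt_eq_zero hlt
    (fun x hx => (hf x (hsub hx)).continuousAt.continuousWithinAt) heq
    (fun x hx => hf x (hsub (Set.Ioo_subset_Icc_self hx)))
  exact ⟨c, hsub (Set.Ioo_subset_Icc_self hc), hc'⟩

theorem eq_of_hasDerivAt_zero_of_ordConnected {I : Set ℝ} (hI : I.OrdConnected) (hIo : IsOpen I)
    {f : ℝ → ℝ} (hf : ∀ s ∈ I, HasDerivAt f 0 s) {s₁ s₂ : ℝ} (h₁ : s₁ ∈ I) (h₂ : s₂ ∈ I) :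
    f s₁ = f s₂ :=
  hIo.is_const_of_deriv_eq_zero hI.isPreconnected
    (fun x hx => (hf x hx).differentiableAt.differentiableWithinAt) (fun x hx => (hf x hx).deriv)
    h₁ h₂

/-! ### Global coordinates `(u, r) = f(s) + g(t)` -/

/-- A smooth injective map with invertible derivatives is a diffeomorphism onto its image. -/
theorem exists_openPartialHomeomorph_of_injOn {E : Type*} [NormedAddCommGroup E] [NormedSpace ℝ E]
    [CompleteSpace E] {Ψ : E → E} {U : Set E} (hU : IsOpen U) (hΨ : ContDiffOn ℝ ∞ Ψ U)
    (hinj : Set.InjOn Ψ U) (hd : ∀ p ∈ U, ∃ L : E ≃L[ℝ] E, HasFDerivAt Ψ (L : E →L[ℝ] E) p) :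
    ∃ e : OpenPartialHomeomorph E E, e.target = U ∧ e.source = Ψ '' U ∧
      ContDiffOn ℝ ∞ e e.source ∧ ContDiffOn ℝ ∞ e.symm e.target ∧
      ∀ p ∈ U, Ψ p = e.symm p := by
  have hat : ∀ p ∈ U, ContDiffAt ℝ ∞ Ψ p := fun p hp => hΨ.contDiffAt (hU.mem_nhds hp)
  have hopen : IsOpenMap (U.domRestrict Ψ) := by
    rw [isOpenMap_iff_nhds_le]
    rintro ⟨p, hp⟩
    obtain ⟨L, hL⟩ := hd p hp
    have hs : HasStrictFDerivAt Ψ (L : E →L[ℝ] E) p := (hat p hp).hasStrictFDerivAt' hL (by simp)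
    have h1 := hs.map_nhds_eq_of_equiv
    have h2 : Set.domRestrict U Ψ = Ψ ∘ Subtype.val := rfl
    rw [h2, ← Filter.map_map, map_nhds_subtype_coe_eq_nhds hp (hU.mem_nhds hp), h1]
    rfl
  let e₀ : OpenPartialHomeomorph E E :=
    OpenPartialHomeomorph.ofContinuousOpenRestrict (hinj.toPartialEquiv Ψ U)
      hΨ.continuousOn hopen hU
  have hsrc : e₀.source = U := rfl
  have hcoe : ∀ p, e₀ p = Ψ p := fun p => rfl
  refine ⟨e₀.symm, hsrc, rfl, ?_, ?_, fun p _ => rfl⟩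
  · intro q hq
    have hq' : e₀.symm q ∈ U := e₀.map_target hq
    obtain ⟨L, hL⟩ := hd _ hq'
    exact (e₀.contDiffAt_symm hq hL (hat _ hq')).contDiffWithinAt
  · exact hΨ

section Separated

variable {I J : Set ℝ} {f₀ f₁ g₀ g₁ f₀' f₁' g₀' g₁' : ℝ → ℝ}

/-- If a planar sum `f(s) + g(t)` of two curves whose velocities are everywhere linearly
independent takes the same value twice, then the chords of `f` and `g` agree, while by Rolle's
theorem each chord is parallel to a velocity of its curve. -/
theorem injOn_sum_of_det_ne_zero (hI : I.OrdConnected) (hJ : J.OrdConnected)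
    (hf₀ : ∀ s ∈ I, HasDerivAt f₀ (f₀' s) s) (hf₁ : ∀ s ∈ I, HasDerivAt f₁ (f₁' s) s)
    (hg₀ : ∀ t ∈ J, HasDerivAt g₀ (g₀' t) t) (hg₁ : ∀ t ∈ J, HasDerivAt g₁ (g₁' t) t)
    (hdet : ∀ s ∈ I, ∀ t ∈ J, f₀' s * g₁' t - f₁' s * g₀' t ≠ 0) :
    Set.InjOn (fun p : ℝ × ℝ => (f₀ p.1 + g₀ p.2, f₁ p.1 + g₁ p.2)) (I ×ˢ J) := by
  rintro ⟨s, t⟩ ⟨hs, ht⟩ ⟨s', t'⟩ ⟨hs', ht'⟩ heq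
  simp only [Prod.mk.injEq] at heq hs ht hs' ht'
  obtain ⟨h0, h1⟩ := heq
  have hF : ∀ x y : ℝ, ∀ σ ∈ I, HasDerivAt (fun σ => x * f₀ σ + y * f₁ σ)
      (x * f₀' σ + y * f₁' σ) σ := fun x y σ hσ =>
    ((hf₀ σ hσ).const_mul x).add ((hf₁ σ hσ).const_mul y)
  have hG : ∀ x y : ℝ, ∀ τ ∈ J, HasDerivAt (fun τ => x * g₀ τ + y * g₁ τ)
      (x * g₀' τ + y * g₁' τ) τ := fun x y τ hτ =>
    ((hg₀ τ hτ).const_mul x).add ((hg₁ τ hτ).const_mul y)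
  -- a curve transversal to the velocities of the other one has no closed chord
  have hsne : s ≠ s' → ¬ (f₀ s = f₀ s' ∧ f₁ s = f₁ s') := by
    rintro hne ⟨e0, e1⟩
    obtain ⟨σ, hσ, h⟩ := exists_deriv_eq_zero_of_ordConnected hI (hF (g₁' t) (-g₀' t)) hs hs' hne
      (by rw [e0, e1])
    exact hdet σ hσ t ht (by linarith)
  have htne : t ≠ t' → ¬ (g₀ t = g₀ t' ∧ g₁ t = g₁ t') := by
    rintro hne ⟨e0, e1⟩
    obtain ⟨τ, hτ, h⟩ := exists_deriv_eq_zero_of_ordConnected hJ (hG (f₁' s) (-f₀' s)) ht ht' hne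
      (by rw [e0, e1])
    exact hdet s hs τ hτ (by linarith)
  by_cases hst : s = s'
  · subst hst
    by_cases htt : t = t'
    · rw [htt]
    · exact absurd ⟨by linarith, by linarith⟩ (htne htt)
  by_cases htt : t = t'
  · subst htt
    exact absurd ⟨by linarith, by linarith⟩ (hsne hst)
  -- both velocities found here are parallel to the nonzero common chord
  obtain ⟨σ, hσ, hσ0⟩ := exists_deriv_eq_zero_of_ordConnected hI
    (hF (f₁ s - f₁ s') (-(f₀ s - f₀ s'))) hs hs' hst (by ring)
  obtain ⟨τ, hτ, hτ0⟩ := exists_deriv_eq_zero_of_ordConnected hJ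
    (hG (f₁ s - f₁ s') (-(f₀ s - f₀ s'))) ht ht' htt (by
      rw [show f₁ s - f₁ s' = g₁ t' - g₁ t by linarith,
        show f₀ s - f₀ s' = g₀ t' - g₀ t by linarith]
      ring)
  refine absurd ⟨?_, ?_⟩ (hsne hst)
  · refine sub_eq_zero.mp ((mul_eq_zero.mp ?_).resolve_left (hdet σ hσ τ hτ))
    linear_combination g₀' τ * hσ0 - f₀' σ * hτ0
  · refine sub_eq_zero.mp ((mul_eq_zero.mp ?_).resolve_left (hdet σ hσ τ hτ))
    linear_combination g₁' τ * hσ0 - f₁' σ * hτ0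

theorem hasFDerivAt_sum_of_det_ne_zero {s t : ℝ} {a₀ a₁ b₀ b₁ : ℝ}
    (hf₀ : HasDerivAt f₀ a₀ s) (hf₁ : HasDerivAt f₁ a₁ s)
    (hg₀ : HasDerivAt g₀ b₀ t) (hg₁ : HasDerivAt g₁ b₁ t) (hdet : a₀ * b₁ - a₁ * b₀ ≠ 0) :
    ∃ L : (ℝ × ℝ) ≃L[ℝ] (ℝ × ℝ),
      HasFDerivAt (fun p : ℝ × ℝ => (f₀ p.1 + g₀ p.2, f₁ p.1 + g₁ p.2))
        (L : (ℝ × ℝ) →L[ℝ] (ℝ × ℝ)) (s, t) := by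
  let M : ℝ → ℝ → ℝ → ℝ → (ℝ × ℝ) →L[ℝ] (ℝ × ℝ) := fun p q r u =>
    (p • ContinuousLinearMap.fst ℝ ℝ ℝ + q • ContinuousLinearMap.snd ℝ ℝ ℝ).prod
      (r • ContinuousLinearMap.fst ℝ ℝ ℝ + u • ContinuousLinearMap.snd ℝ ℝ ℝ)
  let d := a₀ * b₁ - a₁ * b₀
  have hd : d ≠ 0 := hdet
  refine ⟨ContinuousLinearEquiv.equivOfInverse (M a₀ b₀ a₁ b₁)
    (M (b₁ / d) (-b₀ / d) (-a₁ / d) (a₀ / d)) ?_ ?_, ?_⟩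
  · rintro ⟨x, y⟩
    simp only [M, ContinuousLinearMap.prod_apply, add_apply,
      smul_apply, ContinuousLinearMap.coe_fst', ContinuousLinearMap.coe_snd',
      smul_eq_mul, Prod.mk.injEq]
    constructor <;> field_simp <;> simp only [d] <;> ring
  · rintro ⟨x, y⟩
    simp only [M, ContinuousLinearMap.prod_apply, add_apply,
      smul_apply, ContinuousLinearMap.coe_fst', ContinuousLinearMap.coe_snd',
      smul_eq_mul, Prod.mk.injEq]
    constructor <;> field_simp <;> simp only [d] <;> ring
  · have hF : ∀ {f : ℝ → ℝ} {a : ℝ}, HasDerivAt f a s →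
        HasFDerivAt (fun p : ℝ × ℝ => f p.1) (a • ContinuousLinearMap.fst ℝ ℝ ℝ) (s, t) :=
      fun {f a} h => HasDerivAt.comp_hasFDerivAt (x := (s, t)) (f := Prod.fst) h hasFDerivAt_fst
    have hG : ∀ {f : ℝ → ℝ} {a : ℝ}, HasDerivAt f a t →
        HasFDerivAt (fun p : ℝ × ℝ => f p.2) (a • ContinuousLinearMap.snd ℝ ℝ ℝ) (s, t) :=
      fun {f a} h => HasDerivAt.comp_hasFDerivAt (x := (s, t)) (f := Prod.snd) h hasFDerivAt_snd
    exact ((hF hf₀).add (hG hg₀)).prodMk ((hF hf₁).add (hG hg₁))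

/-- The surface is cylindrical as soon as its rulings `γ(u) + r v` can be reached through
coordinates `(u, r) = f(s) + g(t)` with nonvanishing Jacobian: these are automatically global. -/
theorem isCylindrical_of_det_ne_zero {X : ℝ → ℝ → E3} {v : E3} {γ : ℝ → E3}
    (hIo : IsOpen I) (hJo : IsOpen J) (hI : I.OrdConnected) (hJ : J.OrdConnected)
    (hf₀ : ContDiffOn ℝ ∞ f₀ I) (hf₁ : ContDiffOn ℝ ∞ f₁ I)
    (hg₀ : ContDiffOn ℝ ∞ g₀ J) (hg₁ : ContDiffOn ℝ ∞ g₁ J)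
    (hdet : ∀ s ∈ I, ∀ t ∈ J, deriv f₀ s * deriv g₁ t - deriv f₁ s * deriv g₀ t ≠ 0)
    (hv : v ≠ 0) (hγ : ContDiffOn ℝ ∞ γ ((fun p : ℝ × ℝ => f₀ p.1 + g₀ p.2) '' I ×ˢ J))
    (hX : ∀ s ∈ I, ∀ t ∈ J, X s t = γ (f₀ s + g₀ t) + (f₁ s + g₁ t) • v) :
    IsCylindrical X (I ×ˢ J) := by
  have h1 : Set.MapsTo (Prod.fst : ℝ × ℝ → ℝ) (I ×ˢ J) I := fun p hp => hp.1
  have h2 : Set.MapsTo (Prod.snd : ℝ × ℝ → ℝ) (I ×ˢ J) J := fun p hp => hp.2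
  obtain ⟨e, het, hes, he, hesymm, heΨ⟩ := exists_openPartialHomeomorph_of_injOn (hIo.prod hJo)
    (Ψ := fun p : ℝ × ℝ => (f₀ p.1 + g₀ p.2, f₁ p.1 + g₁ p.2))
    (((hf₀.comp contDiffOn_fst h1).add (hg₀.comp contDiffOn_snd h2)).prodMk
      ((hf₁.comp contDiffOn_fst h1).add (hg₁.comp contDiffOn_snd h2)))
    (injOn_sum_of_det_ne_zero hI hJ (fun s hs => hf₀.hasDerivAt_of_isOpen hIo hs)
      (fun s hs => hf₁.hasDerivAt_of_isOpen hIo hs) (fun t ht => hg₀.hasDerivAt_of_isOpen hJo ht)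
      (fun t ht => hg₁.hasDerivAt_of_isOpen hJo ht) hdet)
    (fun p hp => hasFDerivAt_sum_of_det_ne_zero (hf₀.hasDerivAt_of_isOpen hIo hp.1)
      (hf₁.hasDerivAt_of_isOpen hIo hp.1) (hg₀.hasDerivAt_of_isOpen hJo hp.2)
      (hg₁.hasDerivAt_of_isOpen hJo hp.2) (hdet p.1 hp.1 p.2 hp.2))
  refine ⟨v, γ, e, hv, het, he, hesymm, ?_, ?_⟩
  · rw [hes, Set.image_image]
    exact hγ
  · intro q hq
    have hq' : e q ∈ I ×ˢ J := het ▸ e.map_source hq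
    have h3 := heΨ _ hq'
    rw [e.left_inv hq, Prod.ext_iff] at h3
    rw [hX _ hq'.1 _ hq'.2, ← h3.1, ← h3.2]

end Separated

/-! ### Curves whose velocity keeps its direction or its plane -/

theorem hasDerivAt_const_inner {E : Type*} [NormedAddCommGroup E] [InnerProductSpace ℝ E]
    {f : ℝ → E} {f' : E} {t : ℝ} (n : E) (hf : HasDerivAt f f' t) :
    HasDerivAt (fun t => inner ℝ n (f t)) (inner ℝ n f') t := by
  simpa using (hasDerivAt_const t n).inner ℝ hf

theorem inner_deriv_eq_zero {E : Type*} [NormedAddCommGroup E] [InnerProductSpace ℝ E]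
    {f : ℝ → E} {f' n : E} {s : ℝ} (hf : HasDerivAt f f' s)
    (h : ∀ᶠ x in nhds s, inner ℝ n (f x) = 0) : inner ℝ n f' = 0 :=
  (hasDerivAt_const_inner n hf).unique ((hasDerivAt_const s (0 : ℝ)).congr_of_eventuallyEq h)

theorem inner_eq_of_inner_deriv_eq_zero {E : Type*} [NormedAddCommGroup E] [InnerProductSpace ℝ E]
    {I : Set ℝ} (hI : I.OrdConnected) (hIo : IsOpen I) {f f' : ℝ → E} {n : E}
    (hf : ∀ s ∈ I, HasDerivAt f (f' s) s) (h : ∀ s ∈ I, inner ℝ n (f' s) = 0) {s₁ s₂ : ℝ}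
    (h₁ : s₁ ∈ I) (h₂ : s₂ ∈ I) : inner ℝ n (f s₁) = inner ℝ n (f s₂) :=
  eq_of_hasDerivAt_zero_of_ordConnected hI hIo
    (fun s hs => by simpa only [h s hs] using hasDerivAt_const_inner n (hf s hs)) h₁ h₂

/-- A nonvanishing vector field `b` along an interval stays in the plane `nᗮ` in which it starts if
at every time either its direction is stationary or it lies in that plane: the square of the cosine
of the angle between `n` and `b` has derivative zero. -/
theorem inner_eq_zero_of_cross_eq_zero_or {J : Set ℝ} (hJ : J.OrdConnected) (hJo : IsOpen J)
    {b b' : ℝ → E3} (hb : ∀ t ∈ J, HasDerivAt b (b' t) t) (hb0 : ∀ t ∈ J, b t ≠ 0) {n : E3}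
    (h : ∀ t ∈ J, cross (b t) (b' t) = 0 ∨ inner ℝ n (b t) = 0) {t₀ : ℝ} (ht₀ : t₀ ∈ J)
    (h₀ : inner ℝ n (b t₀) = 0) : ∀ t ∈ J, inner ℝ n (b t) = 0 := by
  have hpos : ∀ t ∈ J, inner ℝ (b t) (b t) ≠ 0 := fun t ht => inner_self_ne_zero.mpr (hb0 t ht)
  have hconst : ∀ t ∈ J, HasDerivAt (fun t => inner ℝ n (b t) ^ 2 / inner ℝ (b t) (b t)) 0 t := by
    intro t ht
    have h1 := ((hasDerivAt_const_inner n (hb t ht)).fun_pow 2).fun_div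
      ((hb t ht).inner ℝ (hb t ht)) (hpos t ht)
    refine h1.congr_deriv ?_
    rw [real_inner_comm (b t) (b' t)]
    rcases h t ht with hc | hz
    · -- the numerator is a multiple of `⟪b × b', n × b⟫`
      have h2 := inner_cross_cross (b t) (b' t) n (b t)
      rw [hc, inner_zero_left, real_inner_comm n (b t), real_inner_comm n (b' t),
        real_inner_comm (b t) (b' t)] at h2
      rw [div_eq_zero_iff]
      left
      push_cast
      linear_combination (2 * inner ℝ n (b t)) * h2
    · simp [hz]
  intro t ht
  have := eq_of_hasDerivAt_zero_of_ordConnected hJ hJo hconst ht ht₀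
  simpa [h₀, hb0 t ht] using this

/-- A regular curve whose acceleration is everywhere parallel to its velocity is a line. -/
theorem exists_eq_add_smul_of_cross_eq_zero {α : ℝ → E3} {I : Set ℝ} (hI : I.OrdConnected)
    (hIo : IsOpen I) (hα : ContDiffOn ℝ ∞ α I) (h0 : ∀ s ∈ I, deriv α s ≠ 0)
    (hc : ∀ s ∈ I, cross (deriv α s) (deriv (deriv α) s) = 0) {s₀ : ℝ} (hs₀ : s₀ ∈ I) :
    ∃ (v : E3) (h : ℝ → ℝ), v ≠ 0 ∧ ContDiffOn ℝ ∞ h I ∧ (∀ s ∈ I, deriv h s ≠ 0) ∧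
      ∀ s ∈ I, α s = α s₀ + h s • v := by
  set v := deriv α s₀ with hvdef
  have hv : v ≠ 0 := h0 s₀ hs₀
  have hvv : inner ℝ v v ≠ 0 := inner_self_ne_zero.mpr hv
  let h : ℝ → ℝ := fun s => inner ℝ v (α s - α s₀) / inner ℝ v v
  have hα' : ∀ s ∈ I, HasDerivAt α (deriv α s) s := fun s hs => hα.hasDerivAt_of_isOpen hIo hs
  have hsm : ContDiffOn ℝ ∞ h I :=
    (contDiffOn_const.inner ℝ (hα.sub contDiffOn_const)).div_const _
  have heq : ∀ s ∈ I, α s = α s₀ + h s • v := by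
    intro s hs
    set w := α s - α s₀ - h s • v with hw
    have hwv : inner ℝ w v = 0 := by
      rw [hw, inner_sub_left, real_inner_smul_left, real_inner_comm]
      simp only [h]
      field_simp
      ring
    have hperp := inner_eq_zero_of_cross_eq_zero_or hI hIo
      (fun s hs => (hα.deriv_infty hIo).hasDerivAt_of_isOpen hIo hs) h0
      (fun s hs => Or.inl (hc s hs)) hs₀ hwv
    have h1 := inner_eq_of_inner_deriv_eq_zero hI hIo hα' hperp hs hs₀
    have h2 : inner ℝ w w = 0 := by
      conv_lhs => rw [hw, inner_sub_right, inner_sub_right, real_inner_smul_right]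
      rw [← hw, h1, hwv]
      ring
    have h3 : w = 0 := inner_self_eq_zero.mp h2
    rw [hw, sub_sub, sub_eq_zero] at h3
    exact h3
  refine ⟨v, h, hv, hsm, fun s hs hz => h0 s hs ?_, heq⟩
  have h1 : HasDerivAt (fun s => α s₀ + h s • v) (deriv h s • v) s :=
    ((hsm.hasDerivAt_of_isOpen hIo hs).smul_const v).const_add _
  have h2 := (h1.congr_of_eventuallyEq
    (Filter.eventually_of_mem (hIo.mem_nhds hs) heq)).deriv
  rw [h2, hz, zero_smul]

/-! ### Adapted orthonormal bases -/

/-- Two orthogonal vectors are completed to an adapted orthonormal basis: `b 2` is the direction of `N`, and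
`b 0` that of `T`. -/
theorem exists_orthonormalBasis_adapted {T N : E3} (hT : T ≠ 0) (hN : N ≠ 0)
    (h : inner ℝ N T = 0) :
    ∃ b : OrthonormalBasis (Fin 3) ℝ E3, b 0 = ‖T‖⁻¹ • T ∧ b 2 = ‖N‖⁻¹ • N := by
  have hT' : ‖T‖ ≠ 0 := norm_ne_zero_iff.mpr hT
  have hN' : ‖N‖ ≠ 0 := norm_ne_zero_iff.mpr hN
  have horth : Orthonormal ℝ (({0, 2} : Set (Fin 3)).domRestrict
      ![‖T‖⁻¹ • T, (0 : E3), ‖N‖⁻¹ • N]) := by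
    constructor
    · rintro ⟨i, hi⟩
      rcases hi with rfl | rfl <;> simp [norm_smul, hT', hN']
    · rintro ⟨i, hi⟩ ⟨j, hj⟩ hij
      rcases hi with rfl | rfl <;> rcases hj with rfl | rfl <;>
        simp_all [real_inner_smul_right, real_inner_comm]
  obtain ⟨b, hb⟩ := horth.exists_orthonormalBasis_extension_of_card_eq (by simp)
  exact ⟨b, by simpa using hb 0 (by simp), by simpa using hb 2 (by simp)⟩

theorem OrthonormalBasis.inner_eq_sum_three {E : Type*} [NormedAddCommGroup E]
    [InnerProductSpace ℝ E] (b : OrthonormalBasis (Fin 3) ℝ E) (x y : E) :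
    inner ℝ x y = inner ℝ (b 0) x * inner ℝ (b 0) y + inner ℝ (b 1) x * inner ℝ (b 1) y +
      inner ℝ (b 2) x * inner ℝ (b 2) y := by
  rw [← b.sum_inner_mul_inner x y, Fin.sum_univ_three]
  simp only [real_inner_comm]

/-! ### Flat translation surfaces -/

namespace IsTranslationSurface

variable {α β : ℝ → E3} {I J : Set ℝ}

theorem hasDerivAt_left (h : IsTranslationSurface α β I J) {s : ℝ} (hs : s ∈ I) :
    HasDerivAt α (deriv α s) s := h.smooth_left.hasDerivAt_of_isOpen h.isOpen_left hs

theorem hasDerivAt_right (h : IsTranslationSurface α β I J) {t : ℝ} (ht : t ∈ J) :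
    HasDerivAt β (deriv β t) t := h.smooth_right.hasDerivAt_of_isOpen h.isOpen_right ht

theorem hasDerivAt_deriv_left (h : IsTranslationSurface α β I J) {s : ℝ} (hs : s ∈ I) :
    HasDerivAt (deriv α) (deriv (deriv α) s) s :=
  (h.smooth_left.deriv_infty h.isOpen_left).hasDerivAt_of_isOpen h.isOpen_left hs

theorem hasDerivAt_deriv_right (h : IsTranslationSurface α β I J) {t : ℝ} (ht : t ∈ J) :
    HasDerivAt (deriv β) (deriv (deriv β) t) t :=
  (h.smooth_right.deriv_infty h.isOpen_right).hasDerivAt_of_isOpen h.isOpen_right ht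

theorem deriv_left_ne_zero (h : IsTranslationSurface α β I J) {s : ℝ} (hs : s ∈ I) :
    deriv α s ≠ 0 := by
  obtain ⟨t, ht⟩ := h.nonempty_right
  intro h0
  refine h.cross_ne_zero hs ht ?_
  rw [h0]
  apply E3.ext_coord <;> simp

theorem deriv_right_ne_zero (h : IsTranslationSurface α β I J) {t : ℝ} (ht : t ∈ J) :
    deriv β t ≠ 0 := by
  obtain ⟨s, hs⟩ := h.nonempty_left
  intro h0
  refine h.cross_ne_zero hs ht ?_
  rw [h0]
  apply E3.ext_coord <;> simp

theorem isCylindrical_of_left_line (h : IsTranslationSurface α β I J)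
    (hc : ∀ s ∈ I, cross (deriv α s) (deriv (deriv α) s) = 0) :
    IsCylindrical (translationMap α β) (I ×ˢ J) := by
  obtain ⟨s₀, hs₀⟩ := h.nonempty_left
  obtain ⟨v, f, hv, hf, hf', heq⟩ := exists_eq_add_smul_of_cross_eq_zero h.ordConnected_left
    h.isOpen_left h.smooth_left (fun s hs => h.deriv_left_ne_zero hs) hc hs₀
  refine isCylindrical_of_det_ne_zero (f₀ := fun _ => 0) (g₀ := fun t => t) (f₁ := f)
    (g₁ := fun _ => 0) (γ := fun u => α s₀ + β u) h.isOpen_left h.isOpen_right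
    h.ordConnected_left h.ordConnected_right contDiffOn_const hf contDiffOn_id contDiffOn_const
    ?_ hv ?_ ?_
  · intro s hs t ht
    simpa using hf' s hs
  · refine contDiffOn_const.add (h.smooth_right.mono ?_)
    rintro _ ⟨p, hp, rfl⟩
    simpa using hp.2
  · intro s hs t ht
    simp only [translationMap, heq s hs, zero_add, add_zero]
    abel

theorem isCylindrical_of_right_line (h : IsTranslationSurface α β I J)
    (hc : ∀ t ∈ J, cross (deriv β t) (deriv (deriv β) t) = 0) :
    IsCylindrical (translationMap α β) (I ×ˢ J) := by
  obtain ⟨t₀, ht₀⟩ := h.nonempty_right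
  obtain ⟨v, g, hv, hg, hg', heq⟩ := exists_eq_add_smul_of_cross_eq_zero h.ordConnected_right
    h.isOpen_right h.smooth_right (fun t ht => h.deriv_right_ne_zero ht) hc ht₀
  refine isCylindrical_of_det_ne_zero (f₀ := fun s => s) (g₀ := fun _ => 0) (f₁ := fun _ => 0)
    (g₁ := g) (γ := fun u => α u + β t₀) h.isOpen_left h.isOpen_right
    h.ordConnected_left h.ordConnected_right contDiffOn_id contDiffOn_const contDiffOn_const hg
    ?_ hv ?_ ?_
  · intro s hs t ht
    simpa using hg' t ht
  · refine ContDiffOn.add (h.smooth_left.mono ?_) contDiffOn_const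
    rintro _ ⟨p, hp, rfl⟩
    simpa using hp.1
  · intro s hs t ht
    simp only [translationMap, heq t ht, zero_add, add_zero]
    abel

theorem isCylindrical_of_planar (h : IsTranslationSurface α β I J) {M : E3} (hM : M ≠ 0)
    (hα : ∀ s ∈ I, inner ℝ M (deriv α s) = 0) (hβ : ∀ t ∈ J, inner ℝ M (deriv β t) = 0) :
    IsCylindrical (translationMap α β) (I ×ˢ J) := by
  obtain ⟨s₀, hs₀⟩ := h.nonempty_left
  obtain ⟨t₀, ht₀⟩ := h.nonempty_right
  obtain ⟨b, -, hb⟩ := exists_orthonormalBasis_adapted (h.deriv_left_ne_zero hs₀) hM (hα s₀ hs₀)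
  have hα2 : ∀ s ∈ I, inner ℝ (b 2) (deriv α s) = 0 := fun s hs => by
    rw [hb, real_inner_smul_left, hα s hs, mul_zero]
  have hβ2 : ∀ t ∈ J, inner ℝ (b 2) (deriv β t) = 0 := fun t ht => by
    rw [hb, real_inner_smul_left, hβ t ht, mul_zero]
  have hsα : ∀ i, ContDiffOn ℝ ∞ (fun s => inner ℝ (b i) (α s)) I := fun i =>
    contDiffOn_const.inner ℝ h.smooth_left
  have hsβ : ∀ i, ContDiffOn ℝ ∞ (fun t => inner ℝ (b i) (β t)) J := fun i =>
    contDiffOn_const.inner ℝ h.smooth_right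
  refine isCylindrical_of_det_ne_zero (v := b 1)
    (γ := fun u => u • b 0 + (inner ℝ (b 2) (α s₀) + inner ℝ (b 2) (β t₀)) • b 2)
    h.isOpen_left h.isOpen_right h.ordConnected_left h.ordConnected_right (hsα 0) (hsα 1)
    (hsβ 0) (hsβ 1) ?_ ?_ ?_ ?_
  · intro s hs t ht hz
    have ha := fun i => (hasDerivAt_const_inner (b i) (h.hasDerivAt_left hs)).deriv
    have hb' := fun i => (hasDerivAt_const_inner (b i) (h.hasDerivAt_right ht)).deriv
    rw [ha, ha, hb', hb'] at hz
    apply h.cross_ne_zero hs ht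
    rw [← inner_self_eq_zero (𝕜 := ℝ), inner_cross_cross]
    simp only [b.inner_eq_sum_three (deriv α s), b.inner_eq_sum_three (deriv β t), hα2 s hs,
      hβ2 t ht]
    linear_combination (inner ℝ (b 0) (deriv α s) * inner ℝ (b 1) (deriv β t) -
      inner ℝ (b 1) (deriv α s) * inner ℝ (b 0) (deriv β t)) * hz
  · exact b.orthonormal.ne_zero 1
  · exact ContDiff.contDiffOn (by fun_prop)
  · intro s hs t ht
    have h1 := inner_eq_of_inner_deriv_eq_zero h.ordConnected_left h.isOpen_left
      (fun s hs => h.hasDerivAt_left hs) hα2 hs hs₀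
    have h2 := inner_eq_of_inner_deriv_eq_zero h.ordConnected_right h.isOpen_right
      (fun s hs => h.hasDerivAt_right hs) hβ2 ht ht₀
    have h3 := b.sum_repr' (translationMap α β s t)
    rw [Fin.sum_univ_three] at h3
    rw [← h3]
    simp only [translationMap, inner_add_right, ← h1, ← h2]
    abel

/-- Where `β'' ∦ β'`, the vanishing of the curvature forces `det(α', α'', β') = 0`: otherwise
`α'` would move inside the fixed plane of `β'` and `β''`, which then contains `α'` and `α''`. -/
theorem inner_cross_left_eq_zero (h : IsTranslationSurface α β I J)
    (hK : ∀ s ∈ I, ∀ t ∈ J, inner ℝ (cross (deriv α s) (deriv (deriv α) s)) (deriv β t) = 0 ∨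
      inner ℝ (cross (deriv β t) (deriv (deriv β) t)) (deriv α s) = 0)
    {s t : ℝ} (hs : s ∈ I) (ht : t ∈ J) (hc : cross (deriv β t) (deriv (deriv β) t) ≠ 0) :
    inner ℝ (cross (deriv α s) (deriv (deriv α) s)) (deriv β t) = 0 := by
  by_contra hne
  have hcont : ContinuousAt
      (fun s => inner ℝ (cross (deriv α s) (deriv (deriv α) s)) (deriv β t)) s := by
    have c1 := (h.hasDerivAt_deriv_left hs).continuousAt
    have c2 := (((h.smooth_left.deriv_infty h.isOpen_left).deriv_infty
      h.isOpen_left).hasDerivAt_of_isOpen h.isOpen_left hs).continuousAt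
    simp only [inner_eq_sum, cross_apply_zero, cross_apply_one, cross_apply_two]
    fun_prop
  have hev : ∀ᶠ x in nhds s,
      inner ℝ (cross (deriv β t) (deriv (deriv β) t)) (deriv α x) = 0 := by
    filter_upwards [hcont.eventually_ne hne, h.isOpen_left.mem_nhds hs] with x hx hxI
    exact (hK x hxI t ht).resolve_left hx
  exact hne (inner_cross_eq_zero_of_orthogonal hc hev.self_of_nhds
    (inner_deriv_eq_zero (h.hasDerivAt_deriv_left hs) hev) (inner_cross_self_left _ _))

theorem swap (h : IsTranslationSurface α β I J) : IsTranslationSurface β α J I where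
  isOpen_left := h.isOpen_right
  isOpen_right := h.isOpen_left
  ordConnected_left := h.ordConnected_right
  ordConnected_right := h.ordConnected_left
  nonempty_left := h.nonempty_right
  nonempty_right := h.nonempty_left
  smooth_left := h.smooth_right
  smooth_right := h.smooth_left
  regular := fun t ht s hs => by
    have h1 := h.cross_ne_zero hs ht
    rw [linearIndependent_iff_cross_ne_zero, partialS_translationMap, partialT_translationMap]
    contrapose! h1
    rw [cross_eq_neg_cross_swap, h1, neg_zero]

theorem isCylindrical_of_gaussCurvature_eq_zero (h : IsTranslationSurface α β I J)
    (hK : ∀ s ∈ I, ∀ t ∈ J, gaussCurvature (translationMap α β) s t = 0) :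
    IsCylindrical (translationMap α β) (I ×ˢ J) := by
  have hprod : ∀ s ∈ I, ∀ t ∈ J,
      inner ℝ (cross (deriv α s) (deriv (deriv α) s)) (deriv β t) = 0 ∨
      inner ℝ (cross (deriv β t) (deriv (deriv β) t)) (deriv α s) = 0 := by
    intro s hs t ht
    have h1 := gaussCurvature_translationMap_mul α β s t (h.cross_ne_zero hs ht)
    rw [hK s hs t ht, zero_mul] at h1
    rw [← mul_eq_zero, ← neg_eq_zero, h1]
    simp [inner_eq_sum]
    ring
  by_cases hα : ∀ s ∈ I, cross (deriv α s) (deriv (deriv α) s) = 0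
  · exact h.isCylindrical_of_left_line hα
  by_cases hβ : ∀ t ∈ J, cross (deriv β t) (deriv (deriv β) t) = 0
  · exact h.isCylindrical_of_right_line hβ
  push Not at hα hβ
  obtain ⟨s₀, hs₀, hα⟩ := hα
  obtain ⟨t₀, ht₀, hβ⟩ := hβ
  set M := cross (deriv β t₀) (deriv (deriv β) t₀) with hM
  have hMα : ∀ s ∈ I, inner ℝ M (deriv α s) = 0 := by
    have h0 : ∀ s ∈ I, cross (deriv α s) (deriv (deriv α) s) ≠ 0 → inner ℝ M (deriv α s) = 0 :=
      fun s hs hc => h.swap.inner_cross_left_eq_zero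
        (fun t ht s hs => (hprod s hs t ht).symm) ht₀ hs hc
    exact inner_eq_zero_of_cross_eq_zero_or h.ordConnected_left h.isOpen_left
      (fun s hs => h.hasDerivAt_deriv_left hs) (fun s hs => h.deriv_left_ne_zero hs)
      (fun s hs => or_iff_not_imp_left.mpr (h0 s hs)) hs₀ (h0 s₀ hs₀ hα)
  have hMα' : inner ℝ M (deriv (deriv α) s₀) = 0 :=
    inner_deriv_eq_zero (h.hasDerivAt_deriv_left hs₀)
      (Filter.eventually_of_mem (h.isOpen_left.mem_nhds hs₀) hMα)
  refine h.isCylindrical_of_planar hβ hMα ?_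
  refine inner_eq_zero_of_cross_eq_zero_or h.ordConnected_right h.isOpen_right
    (fun t ht => h.hasDerivAt_deriv_right ht) (fun t ht => h.deriv_right_ne_zero ht)
    (fun t ht => or_iff_not_imp_left.mpr fun hc => ?_) ht₀ (inner_cross_self_left _ _)
  -- `M` is normal to the osculating plane of `α` at `s₀`, and `β' t` lies in that plane
  have h1 := h.inner_cross_left_eq_zero hprod hs₀ ht hc
  set n := cross (deriv α s₀) (deriv (deriv α) s₀) with hn
  have h2 : inner ℝ n n * inner ℝ M (deriv β t) = 0 := by
    rw [hn, inner_cross_self_mul, ← hn, h1, hMα s₀ hs₀, hMα']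
    ring
  exact (mul_eq_zero.mp h2).resolve_left (inner_self_ne_zero.mpr hα)

end IsTranslationSurface

/-! ### A quadratic relation along a planar flow -/

/-- The resultant of two quadratic polynomials vanishes at a common root. -/
theorem resultant_eq_zero_of_common_root {a₁ b₁ c₁ a₂ b₂ c₂ z : ℝ}
    (h₁ : a₁ * z ^ 2 + b₁ * z + c₁ = 0) (h₂ : a₂ * z ^ 2 + b₂ * z + c₂ = 0) :
    (a₁ * c₂ - a₂ * c₁) ^ 2 - (a₁ * b₂ - a₂ * b₁) * (b₁ * c₂ - b₂ * c₁) = 0 := by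
  have e1 : (a₁ * b₂ - a₂ * b₁) * z + (a₁ * c₂ - a₂ * c₁) = 0 := by
    linear_combination a₁ * h₂ - a₂ * h₁
  have e2 : (a₁ * c₂ - a₂ * c₁) * z + (b₁ * c₂ - b₂ * c₁) = 0 := by
    by_cases hz : z = 0
    · subst hz
      have k1 : c₁ = 0 := by linarith
      have k2 : c₂ = 0 := by linarith
      rw [k1, k2]; ring
    · apply mul_left_cancel₀ hz
      linear_combination (-c₁) * h₂ + c₂ * h₁
  linear_combination (a₁ * c₂ - a₂ * c₁) * e1 - (a₁ * b₂ - a₂ * b₁) * e2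

open Polynomial in
theorem eval_eq_zero_of_infinite {S : Set ℝ} (hS : S.Infinite) (P : ℝ[X])
    (h : ∀ x ∈ S, P.eval x = 0) (x : ℝ) : P.eval x = 0 := by
  rw [Polynomial.eq_zero_of_infinite_isRoot P (hS.mono h), eval_zero]

theorem eq_zero_of_hasDerivAt_of_eqOn_zero {J : Set ℝ} (hJ : IsOpen J) {f : ℝ → ℝ} {f' t : ℝ}
    (ht : t ∈ J) (h : ∀ t ∈ J, f t = 0) (hf : HasDerivAt f f' t) : f' = 0 :=
  hf.unique ((hasDerivAt_const t (0 : ℝ)).congr_of_eventuallyEq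
    (Filter.eventually_of_mem (hJ.mem_nhds ht) h))

/-- The two successive differentiations of the quadratic relation `h` along the flow of `(q, z)`
produce two quadratic equations for `z` with coefficients polynomial in `q`, whose resultant
vanishes identically only for `μ = ν = 0`; in that case `q z² = 0`, which contradicts `h`. -/
theorem false_of_quadratic_along_flow {J : Set ℝ} (hJ : J.OrdConnected) (hJo : IsOpen J)
    (hJne : J.Nonempty) {q z k : ℝ → ℝ} {μ ν : ℝ} (hk : ∀ t ∈ J, k t ≠ 0)
    (hq : ∀ t ∈ J, HasDerivAt q (k t * (1 + q t ^ 2) ^ 2) t)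
    (hz : ∀ t ∈ J, HasDerivAt z (k t * (1 + q t ^ 2) * (2 * q t * z t + μ)) t)
    (h : ∀ t ∈ J, (1 + q t ^ 2) * ((3 * q t ^ 2 + 1) * z t ^ 2 + 2 * μ * q t * z t + ν) + 1 = 0) :
    False := by
  have hw : ∀ t, 1 + q t ^ 2 ≠ 0 := fun t => by positivity
  set κ : ℝ := μ ^ 2 + ν with hκ
  have h₁ : ∀ t ∈ J,
      6 * q t * (2 * q t ^ 2 + 1) * z t ^ 2 + 2 * μ * (4 * q t ^ 2 + 1) * z t + κ * q t = 0 := by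
    intro t ht
    have hq2 := (hq t ht).fun_pow 2
    have hd := eq_zero_of_hasDerivAt_of_eqOn_zero hJo ht h
      (((hq2.const_add 1).fun_mul (((((hq2.const_mul 3).add_const 1).fun_mul
        ((hz t ht).fun_pow 2)).fun_add (((hq t ht).const_mul (2 * μ)).fun_mul (hz t ht))).add_const
          ν)).add_const 1)
    have h0 := h t ht
    refine (mul_eq_zero.mp ?_).resolve_left
      (mul_ne_zero (mul_ne_zero (hk t ht) (hw t)) (hw t))
    push_cast at hd
    linear_combination (1 / 2 : ℝ) * hd
  have h₂ : ∀ t ∈ J,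
      (84 * q t ^ 4 + 66 * q t ^ 2 + 6) * z t ^ 2 + 8 * μ * q t * (7 * q t ^ 2 + 4) * z t +
        (2 * μ ^ 2 * (4 * q t ^ 2 + 1) + κ * (1 + q t ^ 2)) = 0 := by
    intro t ht
    have hq2 := (hq t ht).fun_pow 2
    have hd := eq_zero_of_hasDerivAt_of_eqOn_zero hJo ht h₁
      ((((((hq t ht).const_mul 6).fun_mul ((hq2.const_mul 2).add_const 1)).fun_mul
        ((hz t ht).fun_pow 2)).fun_add ((((hq2.const_mul 4).add_const 1).const_mul
          (2 * μ)).fun_mul (hz t ht))).fun_add ((hq t ht).const_mul κ))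
    refine (mul_eq_zero.mp ?_).resolve_left (mul_ne_zero (hk t ht) (hw t))
    push_cast at hd
    linear_combination hd
  -- `q` is injective, so it takes infinitely many values
  have hinj : Set.InjOn q J := by
    intro t ht t' ht' he
    by_contra hne
    obtain ⟨τ, hτ, h0⟩ := exists_deriv_eq_zero_of_ordConnected hJ hq ht ht' hne he
    exact mul_ne_zero (hk τ hτ) (pow_ne_zero 2 (hw τ)) h0
  have hinf : (q '' J).Infinite := by
    rw [Set.infinite_image_iff hinj]
    exact infinite_of_mem_nhds _ (hJo.mem_nhds hJne.some_mem)
  open Polynomial in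
  have hres : ∀ x : ℝ,
      (6 * x * (2 * x ^ 2 + 1) * (2 * μ ^ 2 * (4 * x ^ 2 + 1) + κ * (1 + x ^ 2)) -
        (84 * x ^ 4 + 66 * x ^ 2 + 6) * (κ * x)) ^ 2 -
      (6 * x * (2 * x ^ 2 + 1) * (8 * μ * x * (7 * x ^ 2 + 4)) -
        (84 * x ^ 4 + 66 * x ^ 2 + 6) * (2 * μ * (4 * x ^ 2 + 1))) *
      (2 * μ * (4 * x ^ 2 + 1) * (2 * μ ^ 2 * (4 * x ^ 2 + 1) + κ * (1 + x ^ 2)) -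
        8 * μ * x * (7 * x ^ 2 + 4) * (κ * x)) = 0 := by
    let P : ℝ[X] :=
      (6 * X * (2 * X ^ 2 + 1) * (2 * C μ ^ 2 * (4 * X ^ 2 + 1) + C κ * (1 + X ^ 2)) -
        (84 * X ^ 4 + 66 * X ^ 2 + 6) * (C κ * X)) ^ 2 -
      (6 * X * (2 * X ^ 2 + 1) * (8 * C μ * X * (7 * X ^ 2 + 4)) -
        (84 * X ^ 4 + 66 * X ^ 2 + 6) * (2 * C μ * (4 * X ^ 2 + 1))) *
      (2 * C μ * (4 * X ^ 2 + 1) * (2 * C μ ^ 2 * (4 * X ^ 2 + 1) + C κ * (1 + X ^ 2)) -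
        8 * C μ * X * (7 * X ^ 2 + 4) * (C κ * X))
    have hP := eval_eq_zero_of_infinite hinf P (by
      rintro _ ⟨t, ht, rfl⟩
      simpa [P] using resultant_eq_zero_of_common_root (h₁ t ht) (h₂ t ht))
    intro x
    simpa [P] using hP x
  have hμ : μ = 0 := by
    by_contra hμ
    have hκ0 : κ = -2 * μ ^ 2 := by
      have h0 := hres 0
      have h3 : μ ^ 2 * (κ + 2 * μ ^ 2) = 0 := by linear_combination (1 / 24 : ℝ) * h0
      linarith [(mul_eq_zero.mp h3).resolve_left (pow_ne_zero 2 hμ)]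
    have h3 := hres 1
    rw [hκ0] at h3
    have h4 : μ ^ 4 = 0 := by linear_combination (1 / 170736 : ℝ) * h3
    exact hμ (pow_eq_zero_iff (by norm_num) |>.mp h4)
  have hκ0 : κ = 0 := by
    have h3 := hres 1
    rw [hμ] at h3
    have h4 : κ ^ 2 = 0 := by linear_combination (1 / 14400 : ℝ) * h3
    exact pow_eq_zero_iff (by norm_num) |>.mp h4
  -- now `q z² = 0`, and the given relation becomes an equation for `q` alone
  open Polynomial in
  have hlast : ∀ x : ℝ, x * ((1 + x ^ 2) * ν + 1) = 0 := by
    let P : ℝ[X] := X * ((1 + X ^ 2) * C ν + 1)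
    have hP := eval_eq_zero_of_infinite hinf P (by
      rintro _ ⟨t, ht, rfl⟩
      have h3 := h₁ t ht
      have h4 := h t ht
      rw [hμ, hκ0] at h3
      rw [hμ] at h4
      have h5 : q t * z t ^ 2 = 0 := by
        have h6 : 2 * q t ^ 2 + 1 ≠ 0 := by positivity
        refine (mul_eq_zero.mp ?_).resolve_left h6
        linear_combination (1 / 6 : ℝ) * h3
      simp only [P, eval_mul, eval_add, eval_pow, eval_X, eval_C, eval_one]
      linear_combination q t * h4 - (1 + q t ^ 2) * (3 * q t ^ 2 + 1) * h5)
    intro x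
    simpa [P] using hP x
  linarith [hlast 1, hlast 2]

/-! ### Constant curvature with a planar generating curve -/

/-- The `m`-derivatives of order one and two, at `m = 0`, of the family of equations
`b' - m a' = c φ (1 + m² + (b - m a)²)²`, whose left-hand side is affine in `m`. Here `φ₁`, `φ₂` are
the derivatives of `φ` with respect to `m`; they do not depend on the other data. -/
theorem exists_derivatives_of_pencil {I : Set ℝ} (hI : IsOpen I) {m φ : ℝ → ℝ} {s₀ : ℝ}
    (hs₀ : s₀ ∈ I) (hm : ContDiffOn ℝ ∞ m I) (hφ : ContDiffOn ℝ ∞ φ I)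
    (hm' : ∀ s ∈ I, deriv m s ≠ 0) (hm0 : m s₀ = 0) :
    ∃ φ₁ φ₂ : ℝ, ∀ a b a' b' c : ℝ, c ≠ 0 →
      (∀ s ∈ I, b' - m s * a' = c * φ s * (1 + m s ^ 2 + (b - m s * a) ^ 2) ^ 2) →
      -a' = c * (φ₁ * (1 + b ^ 2) ^ 2 - 4 * φ s₀ * (1 + b ^ 2) * (b * a)) ∧
      φ₂ * (1 + b ^ 2) ^ 2 - 8 * φ₁ * (1 + b ^ 2) * (b * a) + 8 * φ s₀ * (b * a) ^ 2 +
        4 * φ s₀ * (1 + b ^ 2) * (1 + a ^ 2) = 0 := by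
  let φ₁ : ℝ → ℝ := fun s => deriv φ s / deriv m s
  have hφ₁ : ContDiffOn ℝ ∞ φ₁ I := (hφ.deriv_infty hI).div (hm.deriv_infty hI) hm'
  have hdm : ∀ s ∈ I, HasDerivAt m (deriv m s) s := fun s hs => hm.hasDerivAt_of_isOpen hI hs
  have hdφ : ∀ s ∈ I, HasDerivAt φ (φ₁ s * deriv m s) s := fun s hs => by
    have h1 := hφ.hasDerivAt_of_isOpen hI hs
    rwa [← div_mul_cancel₀ (deriv φ s) (hm' s hs)] at h1
  have hdφ₁ : HasDerivAt φ₁ (deriv φ₁ s₀ / deriv m s₀ * deriv m s₀) s₀ := by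
    rw [div_mul_cancel₀ _ (hm' s₀ hs₀)]
    exact hφ₁.hasDerivAt_of_isOpen hI hs₀
  refine ⟨φ₁ s₀, deriv φ₁ s₀ / deriv m s₀, fun a b a' b' c hc h => ?_⟩
  have hP : ∀ s ∈ I, HasDerivAt (fun s => b - m s * a) (-(deriv m s * a)) s := fun s hs =>
    ((hdm s hs).mul_const a).const_sub b
  have hD : ∀ s ∈ I, HasDerivAt (fun s => 1 + m s ^ 2 + (b - m s * a) ^ 2)
      (deriv m s * (2 * (m s - (b - m s * a) * a))) s := fun s hs => by
    refine ((((hdm s hs).fun_pow 2).const_add 1).fun_add ((hP s hs).fun_pow 2)).congr_deriv ?_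
    push_cast
    ring
  have h1 : ∀ s ∈ I, a' + c * (φ₁ s * (1 + m s ^ 2 + (b - m s * a) ^ 2) ^ 2 +
      4 * (φ s * (1 + m s ^ 2 + (b - m s * a) ^ 2) * (m s - (b - m s * a) * a))) = 0 := by
    intro s hs
    have hd := eq_zero_of_hasDerivAt_of_eqOn_zero hI hs (fun s hs => sub_eq_zero.mpr (h s hs))
      ((((hdm s hs).mul_const a').const_sub b').fun_sub
        (((hdφ s hs).const_mul c).fun_mul ((hD s hs).fun_pow 2)))
    refine (mul_eq_zero.mp ?_).resolve_left (hm' s hs)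
    push_cast at hd
    linear_combination -hd
  constructor
  · have h2 := h1 s₀ hs₀
    rw [hm0] at h2
    linear_combination -h2
  · have hd := eq_zero_of_hasDerivAt_of_eqOn_zero hI hs₀ h1
      ((((hdφ₁.fun_mul ((hD s₀ hs₀).fun_pow 2)).fun_add
        ((((hdφ s₀ hs₀).fun_mul (hD s₀ hs₀)).fun_mul
          ((hdm s₀ hs₀).fun_sub ((hP s₀ hs₀).mul_const a))).const_mul 4)).const_mul c).const_add a')
    rw [hm0] at hd
    refine (mul_eq_zero.mp ?_).resolve_left (mul_ne_zero hc (hm' s₀ hs₀))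
    push_cast at hd
    linear_combination hd

/-- The pencil of equations satisfied by the slopes of a translation surface of constant nonzero
curvature with a planar generating curve has no solutions. -/
theorem false_of_pencil {I J : Set ℝ} (hI : IsOpen I) (hJo : IsOpen J) (hJ : J.OrdConnected)
    (hJne : J.Nonempty) {m φ : ℝ → ℝ} {s₀ : ℝ} (hs₀ : s₀ ∈ I) (hm : ContDiffOn ℝ ∞ m I)
    (hφ : ContDiffOn ℝ ∞ φ I) (hm' : ∀ s ∈ I, deriv m s ≠ 0) (hm0 : m s₀ = 0) (hφ0 : φ s₀ ≠ 0)
    {a b a' b' c : ℝ → ℝ} (ha : ∀ t ∈ J, HasDerivAt a (a' t) t)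
    (hb : ∀ t ∈ J, HasDerivAt b (b' t) t) (hc : ∀ t ∈ J, c t ≠ 0)
    (h : ∀ s ∈ I, ∀ t ∈ J, b' t - m s * a' t =
      c t * φ s * (1 + m s ^ 2 + (b t - m s * a t) ^ 2) ^ 2) : False := by
  obtain ⟨φ₁, φ₂, hφφ⟩ := exists_derivatives_of_pencil hI hs₀ hm hφ hm' hm0
  have hw : ∀ t, 1 + b t ^ 2 ≠ 0 := fun t => by positivity
  have hb' : ∀ t ∈ J, b' t = c t * φ s₀ * (1 + b t ^ 2) ^ 2 := by
    intro t ht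
    have h0 := h s₀ hs₀ t ht
    rw [hm0] at h0
    linear_combination h0
  refine false_of_quadratic_along_flow hJ hJo hJne (q := b) (z := fun t => -a t / (1 + b t ^ 2))
    (k := fun t => c t * φ s₀) (μ := φ₁ / φ s₀) (ν := φ₂ / (4 * φ s₀))
    (fun t ht => mul_ne_zero (hc t ht) hφ0) (fun t ht => hb' t ht ▸ hb t ht) ?_ ?_
  · intro t ht
    obtain ⟨h1, -⟩ := hφφ (a t) (b t) (a' t) (b' t) (c t) (hc t ht) fun s hs => h s hs t ht
    refine (((ha t ht).fun_neg).fun_div (((hb t ht).fun_pow 2).const_add 1) (hw t)).congr_deriv ?_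
    rw [h1, hb' t ht]
    have := hw t
    field_simp
    push_cast
    ring
  · intro t ht
    obtain ⟨-, h2⟩ := hφφ (a t) (b t) (a' t) (b' t) (c t) (hc t ht) fun s hs => h s hs t ht
    have := hw t
    field_simp
    linear_combination h2

namespace IsTranslationSurface

variable {α β : ℝ → E3} {I J : Set ℝ}

/-- In an orthonormal basis adapted to the plane of `α`, the slope `m` of `α'` and the slopes
`a`, `b` of `β'` satisfy `b' - m a' = c φ (1 + m² + (b - m a)²)²`. -/
theorem gaussCurvature_ne_const_of_left_planar (h : IsTranslationSurface α β I J) {K : ℝ}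
    (hK0 : K ≠ 0) (hK : ∀ s ∈ I, ∀ t ∈ J,
      K * inner ℝ (cross (deriv α s) (deriv β t)) (cross (deriv α s) (deriv β t)) ^ 2 =
      inner ℝ (cross (deriv α s) (deriv β t)) (deriv (deriv α) s) *
        inner ℝ (cross (deriv α s) (deriv β t)) (deriv (deriv β) t))
    {N : E3} (hN : N ≠ 0) (hNα : ∀ s ∈ I, inner ℝ N (deriv α s) = 0) : False := by
  obtain ⟨s₀, hs₀⟩ := h.nonempty_left
  obtain ⟨t₀, ht₀⟩ := h.nonempty_right
  obtain ⟨e, he0, he2⟩ := exists_orthonormalBasis_adapted (h.deriv_left_ne_zero hs₀) hN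
    (hNα s₀ hs₀)
  let x : ℝ → ℝ := fun s => inner ℝ (e 0) (deriv α s)
  let y : ℝ → ℝ := fun s => inner ℝ (e 1) (deriv α s)
  let x' : ℝ → ℝ := fun s => inner ℝ (e 0) (deriv (deriv α) s)
  let y' : ℝ → ℝ := fun s => inner ℝ (e 1) (deriv (deriv α) s)
  let p : ℝ → ℝ := fun t => inner ℝ (e 0) (deriv β t)
  let r : ℝ → ℝ := fun t => inner ℝ (e 1) (deriv β t)
  let c : ℝ → ℝ := fun t => inner ℝ (e 2) (deriv β t)
  let p' : ℝ → ℝ := fun t => inner ℝ (e 0) (deriv (deriv β) t)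
  let r' : ℝ → ℝ := fun t => inner ℝ (e 1) (deriv (deriv β) t)
  let c' : ℝ → ℝ := fun t => inner ℝ (e 2) (deriv (deriv β) t)
  have hα2 : ∀ s ∈ I, inner ℝ (e 2) (deriv α s) = 0 := fun s hs => by
    rw [he2, real_inner_smul_left, hNα s hs, mul_zero]
  have hα2' : ∀ s ∈ I, inner ℝ (e 2) (deriv (deriv α) s) = 0 := fun s hs =>
    inner_deriv_eq_zero (h.hasDerivAt_deriv_left hs)
      (Filter.eventually_of_mem (h.isOpen_left.mem_nhds hs) hα2)
  have hx : ∀ s ∈ I, HasDerivAt x (x' s) s := fun s hs =>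
    hasDerivAt_const_inner _ (h.hasDerivAt_deriv_left hs)
  have hy : ∀ s ∈ I, HasDerivAt y (y' s) s := fun s hs =>
    hasDerivAt_const_inner _ (h.hasDerivAt_deriv_left hs)
  have hp : ∀ t ∈ J, HasDerivAt p (p' t) t := fun t ht =>
    hasDerivAt_const_inner _ (h.hasDerivAt_deriv_right ht)
  have hr : ∀ t ∈ J, HasDerivAt r (r' t) t := fun t ht =>
    hasDerivAt_const_inner _ (h.hasDerivAt_deriv_right ht)
  have hc : ∀ t ∈ J, HasDerivAt c (c' t) t := fun t ht =>
    hasDerivAt_const_inner _ (h.hasDerivAt_deriv_right ht)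
  have hx₀ : x s₀ ≠ 0 := by
    have hne : ‖deriv α s₀‖ ≠ 0 := norm_ne_zero_iff.mpr (h.deriv_left_ne_zero hs₀)
    simp only [x, he0, real_inner_smul_left, real_inner_self_eq_norm_sq]
    positivity
  have hy₀ : y s₀ = 0 := by
    have h1 : inner ℝ (e 1) (e 0) = 0 := e.orthonormal.inner_eq_zero (by decide)
    rw [he0, real_inner_smul_right] at h1
    exact (mul_eq_zero.mp h1).resolve_left
      (inv_ne_zero (norm_ne_zero_iff.mpr (h.deriv_left_ne_zero hs₀)))
  -- the curvature equation in coordinates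
  have hcoord : ∀ s ∈ I, ∀ t ∈ J,
      K * (c t ^ 2 * (x s ^ 2 + y s ^ 2) + (x s * r t - y s * p t) ^ 2) ^ 2 =
      c t * (y s * x' s - x s * y' s) *
        (c t * (y s * p' t - x s * r' t) + c' t * (x s * r t - y s * p t)) := by
    intro s hs t ht
    have h1 := hK s hs t ht
    rw [inner_cross_mul_inner_cross, inner_cross_cross] at h1
    simp only [e.inner_eq_sum_three (deriv α s), e.inner_eq_sum_three (deriv β t),
      e.inner_eq_sum_three (deriv (deriv α) s), hα2 s hs, hα2' s hs] at h1
    simp only [x, y, x', y', p, r, c, p', r', c']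
    linear_combination h1
  have hne : ∀ s ∈ I, ∀ t ∈ J, c t * (y s * x' s - x s * y' s) ≠ 0 := by
    intro s hs t ht hz
    have h1 := hcoord s hs t ht
    rw [hz, zero_mul] at h1
    have h2 := (pow_eq_zero_iff two_ne_zero).mp ((mul_eq_zero.mp h1).resolve_left hK0)
    apply h.cross_ne_zero hs ht
    rw [← inner_self_eq_zero (𝕜 := ℝ), inner_cross_cross, ← h2]
    simp only [e.inner_eq_sum_three (deriv α s), e.inner_eq_sum_three (deriv β t), hα2 s hs]
    simp only [x, y, p, r, c]
    ring
  have hc0 : ∀ t ∈ J, c t ≠ 0 := fun t ht => left_ne_zero_of_mul (hne s₀ hs₀ t ht)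
  have hxs : ContDiffOn ℝ ∞ x I :=
    contDiffOn_const.inner ℝ (h.smooth_left.deriv_infty h.isOpen_left)
  have hys : ContDiffOn ℝ ∞ y I :=
    contDiffOn_const.inner ℝ (h.smooth_left.deriv_infty h.isOpen_left)
  let I₀ : Set ℝ := I ∩ x ⁻¹' {0}ᶜ
  have hI₀ : IsOpen I₀ :=
    hxs.continuousOn.isOpen_inter_preimage h.isOpen_left isOpen_compl_singleton
  have hI₀x : ∀ s ∈ I₀, x s ≠ 0 := fun s hs => hs.2
  let m : ℝ → ℝ := fun s => y s / x s
  have hm : ContDiffOn ℝ ∞ m I₀ :=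
    (hys.mono Set.inter_subset_left).div (hxs.mono Set.inter_subset_left) hI₀x
  have hdm : ∀ s ∈ I₀, deriv m s = (y' s * x s - y s * x' s) / x s ^ 2 := fun s hs =>
    ((hy s hs.1).fun_div (hx s hs.1) hs.2).deriv
  have hdm0 : ∀ s ∈ I₀, deriv m s ≠ 0 := by
    intro s hs
    rw [hdm s hs]
    refine div_ne_zero (fun hz => hne s hs.1 t₀ ht₀ ?_) (pow_ne_zero 2 hs.2)
    linear_combination (-c t₀) * hz
  refine false_of_pencil hI₀ h.isOpen_right h.ordConnected_right h.nonempty_right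
    (m := m) (φ := fun s => K * x s / deriv m s) (s₀ := s₀) ⟨hs₀, hx₀⟩ hm
    ((contDiffOn_const.mul (hxs.mono Set.inter_subset_left)).div (hm.deriv_infty hI₀) hdm0) hdm0
    (by simp [m, hy₀]) (div_ne_zero (mul_ne_zero hK0 hx₀) (hdm0 s₀ ⟨hs₀, hx₀⟩))
    (fun t ht => (hp t ht).fun_div (hc t ht) (hc0 t ht))
    (fun t ht => (hr t ht).fun_div (hc t ht) (hc0 t ht)) hc0 ?_
  intro s hs t ht
  have hct := hc0 t ht
  have hxs0 := hI₀x s hs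
  have hd : x s * y' s - y s * x' s ≠ 0 := fun hz => hne s hs.1 t ht (by
    linear_combination (-c t) * hz)
  have h1 := hcoord s hs.1 t ht
  rw [hdm s hs]
  simp only [m]
  field_simp
  linear_combination -h1

end IsTranslationSurface

/-- A coplanar subset of Euclidean three-space lies in a plane with some normal vector. -/
theorem Coplanar.exists_normal {S : Set E3} (hS : Coplanar ℝ S) :
    ∃ N : E3, N ≠ 0 ∧ ∀ x ∈ S, ∀ y ∈ S, inner ℝ N x = inner ℝ N y := by
  have hne : vectorSpan ℝ S ≠ ⊤ := by
    intro htop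
    have h1 : Module.rank ℝ (vectorSpan ℝ S) ≤ 2 := hS
    rw [htop, rank_top, ← Module.finrank_eq_rank, finrank_euclideanSpace_fin] at h1
    exact absurd h1 (by norm_num)
  obtain ⟨N, hN, hN0⟩ := Submodule.exists_mem_ne_zero_of_ne_bot
    (mt Submodule.orthogonal_eq_bot_iff.mp hne)
  refine ⟨N, hN0, fun x hx y hy => ?_⟩
  have h1 := Submodule.inner_left_of_mem_orthogonal (vsub_mem_vectorSpan ℝ hx hy) hN
  rwa [vsub_eq_sub, inner_sub_right, sub_eq_zero] at h1

namespace IsTranslationSurface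

variable {α β : ℝ → E3} {I J : Set ℝ}

theorem exists_normal_of_coplanar (h : IsTranslationSurface α β I J)
    (hα : Coplanar ℝ (α '' I)) : ∃ N : E3, N ≠ 0 ∧ ∀ s ∈ I, inner ℝ N (deriv α s) = 0 := by
  obtain ⟨N, hN, hNα⟩ := hα.exists_normal
  refine ⟨N, hN, fun s hs => ?_⟩
  refine (hasDerivAt_const_inner N (h.hasDerivAt_left hs)).unique
    ((hasDerivAt_const s (inner ℝ N (α s))).congr_of_eventuallyEq
      (Filter.eventually_of_mem (h.isOpen_left.mem_nhds hs) fun u hu =>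
        hNα _ (Set.mem_image_of_mem α hu) _ (Set.mem_image_of_mem α hs)))

end IsTranslationSurface

theorem theorem1 :
    (∀ (α β : ℝ → E3) (I J : Set ℝ), IsTranslationSurface α β I J →
      (∀ s ∈ I, ∀ t ∈ J, gaussCurvature (translationMap α β) s t = 0) →
      IsCylindrical (translationMap α β) (I ×ˢ J)) ∧
    (∀ (α β : ℝ → E3) (I J : Set ℝ), IsTranslationSurface α β I J →
      (Coplanar ℝ (α '' I) ∨ Coplanar ℝ (β '' J)) →
      ¬ ∃ K : ℝ, K ≠ 0 ∧
        ∀ s ∈ I, ∀ t ∈ J, gaussCurvature (translationMap α β) s t = K) := by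
  refine ⟨fun α β I J h hK => h.isCylindrical_of_gaussCurvature_eq_zero hK, ?_⟩
  rintro α β I J h hplanar ⟨K, hK0, hK⟩
  have hprod : ∀ s ∈ I, ∀ t ∈ J,
      K * inner ℝ (cross (deriv α s) (deriv β t)) (cross (deriv α s) (deriv β t)) ^ 2 =
      inner ℝ (cross (deriv α s) (deriv β t)) (deriv (deriv α) s) *
        inner ℝ (cross (deriv α s) (deriv β t)) (deriv (deriv β) t) := fun s hs t ht => by
    rw [← hK s hs t ht, gaussCurvature_translationMap_mul α β s t (h.cross_ne_zero hs ht)]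
  rcases hplanar with hα | hβ
  · obtain ⟨N, hN, hNα⟩ := h.exists_normal_of_coplanar hα
    exact h.gaussCurvature_ne_const_of_left_planar hK0 hprod hN hNα
  · obtain ⟨N, hN, hNβ⟩ := h.swap.exists_normal_of_coplanar hβ
    refine h.swap.gaussCurvature_ne_const_of_left_planar hK0 (fun t ht s hs => ?_) hN hNβ
    have h1 := hprod s hs t ht
    rw [cross_eq_neg_cross_swap (deriv α s)] at h1
    simp only [inner_neg_left, inner_neg_right, neg_neg] at h1
    linear_combination h1
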